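/- We work in the deterministic CONGEST model. The communication network is the (finite, simple, undirected) input graph $G=(V,E)$ with $n=|V|$ nodes, which carry distinct identifiers of at most $c\lceil\log_2(n+1)\rceil$ bits for a constant $c$. Initially each node knows only $n$, its own identifier and the identifiers of its neighbours. In each synchronous round every node may send to each of its neighbours a possibly different message of $O(\log n)$ bits (precisely, at most $B\lceil\log_2(n+1)\rceil$ bits, for a constant $B$ that depends only on $c$), and then updates its state by an arbitrary deterministic local computation. A node halts, and becomes silent, when it fixes its output; the number of rounds is the number of communication rounds after which all nodes have halted. For minimum vertex cover (MVC) each node outputs whether it belongs to the computed cover. For maximum matching (MaxM) each node outputs which of its incident edges belong to the computed matching, and the two ends of an edge agree. $\mathit{OPT}$ denotes the size of an optimal solution of the problem in question on $G$; it is not known to the nodes. An $\alpha$-approximation is a feasible solution of size at most $\alpha\cdot\mathit{OPT}$ for MVC, and of size at least $\mathit{OPT}/\alpha$ for MaxM. **Theorem.** (1) For every $\varepsilon\in(0,1)$ there are deterministic CONGEST algorithms that compute a $(1+\varepsilon)$-approximation of MVC and of MaxM, respectively, on every such network, in $$O\left(\min\{n^2,\ \mathit{OPT}^2\cdot\log(1+1/\varepsilon)\}\right)$$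 rounds. (2) There are deterministic CONGEST algorithms that solve MVC and MaxM exactly, respectively, on every such network, in $$O\left(\min\{n^2,\ \mathit{OPT}^2\cdot\log(1+\mathit{OPT})\}\right)$$ rounds. The constants in the $O(\cdot)$ for the numbers of rounds are absolute; in particular they do not depend on $\varepsilon$. -/

import Mathlib

/-- A deterministic algorithm for synchronous message-passing networks, with local outputs in `O`.
Local computation is free, so its components are arbitrary functions.  A node starts with the
number `n` of nodes of the network, its own identifier and the identifiers of its neighbours.
In every round it may send to each neighbour (addressed by its identifier) a string of bits, the
empty string meaning that nothing is sent; it then updates its state from the set of pairs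
(identifier of the sender, message).  A node halts as soon as its state carries an output. -/
structure DistAlgorithm (O : Type) where
  State : Type
  init : (n self : ℕ) → (nbrs : Finset ℕ) → State
  send : State → (dest : ℕ) → List Bool
  receive : State → (inbox : Finset (ℕ × List Bool)) → State
  output : State → Option O

namespace DistAlgorithm

variable {O V : Type}

/-- The message of a node in state `s` to its neighbour with identifier `dest`; halted nodes
are silent. -/
def message (A : DistAlgorithm O) (s : A.State) (dest : ℕ) : List Bool :=
  if (A.output s).isSome then [] else A.send s dest

/-- The state of every node after `t` rounds on the network `G` with node identifiers `id`.
The state of a halted node never changes again. -/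
def stateAfter (A : DistAlgorithm O) [Fintype V] (G : SimpleGraph V) [DecidableRel G.Adj]
    (id : V → ℕ) : ℕ → V → A.State
  | 0, v => A.init (Fintype.card V) (id v) ((G.neighborFinset v).image id)
  | t + 1, v =>
      if (A.output (A.stateAfter G id t v)).isSome then A.stateAfter G id t v
      else A.receive (A.stateAfter G id t v)
        ((G.neighborFinset v).image fun u => (id u, A.message (A.stateAfter G id t u) (id v)))

/-- On the network `G` with node identifiers `id`, all messages that are ever sent have at most `b`
bits, and after `T` rounds all nodes have halted, node `v` with output `out v`. -/
def Computes (A : DistAlgorithm O) [Fintype V] (G : SimpleGraph V) [DecidableRel G.Adj]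
    (id : V → ℕ) (b T : ℕ) (out : V → O) : Prop :=
  (∀ (t : ℕ) (u v : V), G.Adj u v → (A.message (A.stateAfter G id t u) (id v)).length ≤ b) ∧
    ∀ v, A.output (A.stateAfter G id T v) = some (out v)

end DistAlgorithm

/-- Distinct identifiers of at most `c * (bit length of n)` bits, where `n` is the number of
nodes. -/
def ValidIds {V : Type} [Fintype V] (c : ℕ) (id : V → ℕ) : Prop :=
  Function.Injective id ∧ ∀ v, (id v).size ≤ c * (Fintype.card V).size

/-- The maximum number of edges of a matching of `G`. -/
noncomputable def maxMatchingSize {V : Type} (G : SimpleGraph V) : ℕ :=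
  sSup {m | ∃ M : G.Subgraph, M.IsMatching ∧ M.edgeSet.ncard = m}

/-- `A` is a CONGEST algorithm that, on all networks with identifiers of at most
`c * (bit length of n)` bits, sends messages of at most `B * (bit length of n)` bits and computes
an `α`-approximate minimum vertex cover (each node outputs whether it is in the cover) in at most
`R n OPT` rounds, where `n` is the number of nodes and `OPT` the minimum size of a vertex cover. -/
def ApproximatesMVC (A : DistAlgorithm Bool) (c B : ℕ) (α : ℝ) (R : ℕ → ℕ → ℝ) : Prop :=
  ∀ (V : Type) [Fintype V] (G : SimpleGraph V) [DecidableRel G.Adj] (id : V → ℕ), ValidIds c id →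
    ∃ (T : ℕ) (out : V → Bool),
      (T : ℝ) ≤ R (Fintype.card V) G.vertexCoverNum.toNat ∧
      A.Computes G id (B * (Fintype.card V).size) T out ∧
      G.IsVertexCover {v | out v = true} ∧
      ({v | out v = true}.ncard : ℝ) ≤ α * (G.vertexCoverNum.toNat : ℝ)

/-- `A` is a CONGEST algorithm that, on all networks with identifiers of at most
`c * (bit length of n)` bits, sends messages of at most `B * (bit length of n)` bits and computes
an `α`-approximate maximum matching in at most `R n OPT` rounds, where `n` is the number of nodes
and `OPT` the maximum size of a matching.  Each node outputs the identifiers of those neighbours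
to which it is joined by a solution edge, and the two ends of an edge must agree. -/
def ApproximatesMaxM (A : DistAlgorithm (Finset ℕ)) (c B : ℕ) (α : ℝ) (R : ℕ → ℕ → ℝ) : Prop :=
  ∀ (V : Type) [Fintype V] (G : SimpleGraph V) [DecidableRel G.Adj] (id : V → ℕ), ValidIds c id →
    ∃ (T : ℕ) (out : V → Finset ℕ) (M : G.Subgraph),
      (T : ℝ) ≤ R (Fintype.card V) (maxMatchingSize G) ∧
      A.Computes G id (B * (Fintype.card V).size) T out ∧
      (∀ v i, i ∈ out v ↔ ∃ u, M.Adj v u ∧ id u = i) ∧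
      M.IsMatching ∧
      (maxMatchingSize G : ℝ) / α ≤ (M.edgeSet.ncard : ℝ)

/-! The logarithms are slack: both problems are solved exactly in `O(OPT ^ 2)` rounds, and `OPT ≤ n`
together with `log (1 + x) ≥ 1 / 2` for `x ≥ 1` yields all the bounds (`rounds_le`).

For a guess `d` of the cover size, each component is replaced by a kernel in the style of Buss: a
vertex of degree above `2 * d` contributes only `2 * d + 1` of its edges, and all edges between the
other vertices are kept. A cover of the kernel with at most `2 * d` vertices must contain every
high-degree vertex and therefore covers the network (`cover_of_cover_kernel`). If the kernel has a
cover of size `d`, an exchange argument shows that omitting edges did not shrink the maximum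
matching (`IsPairing.card_le_of_kernel`). If the network has a cover of size `d`, the kernel has at
most `4 * d ^ 2 + d` edges (`sparse_componentTokens`), so pipelined gossip, one edge per message,
spreads it in `O(d ^ 2)` rounds (`gossip_progress`).

Whether the guess was large enough is detected locally. A node that sees few edges with a cover of
size `d` knows the kernel within distance `2 * d + 1`. If its component reached further, a shortest
path would contain `d + 1` disjoint edges, too many for `d` vertices to cover
(`finalTokens_eq_of_sparse`). So all nodes of a component hold the same kernel, halt simultaneously
and read their outputs off the same optimum. The guesses `2 ^ i` cost a geometric sum of rounds. -/

/-! ### Matchings as symmetric sets of ordered pairs -/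

/-- A matching of the relation `r`, given as a symmetric set of ordered pairs. -/
def IsPairing {α : Type} (r : α → α → Prop) (M : Finset (α × α)) : Prop :=
  (∀ a b, (a, b) ∈ M → r a b ∧ (b, a) ∈ M) ∧ ∀ a b c, (a, b) ∈ M → (a, c) ∈ M → b = c

namespace IsPairing

variable {α β : Type} {r t : α → α → Prop} {M : Finset (α × α)}

theorem empty : IsPairing r ∅ := by simp [IsPairing]

theorem eq_left (h : IsPairing r M) {a b c : α} (hb : (b, a) ∈ M) (hc : (c, a) ∈ M) : b = c :=
  h.2 a b c (h.1 _ _ hb).2 (h.1 _ _ hc).2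

theorem mono (h : IsPairing r M) (hrt : ∀ a b, (a, b) ∈ M → t a b) : IsPairing t M :=
  ⟨fun a b hab => ⟨hrt a b hab, (h.1 a b hab).2⟩, h.2⟩

theorem erase [DecidableEq α] (h : IsPairing r M) (v w : α) :
    IsPairing r ((M.erase (v, w)).erase (w, v)) := by
  refine ⟨fun a b hab => ?_, fun a b c hb hc => ?_⟩
  · simp only [Finset.mem_erase, ne_eq, Prod.mk.injEq] at hab ⊢
    have := h.1 a b hab.2.2
    tauto
  · simp only [Finset.mem_erase] at hb hc
    exact h.2 a b c hb.2.2 hc.2.2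

theorem insert [DecidableEq α] (h : IsPairing r M) {v x : α} (hvx : r v x) (hxv : r x v)
    (hne : v ≠ x) (hv : ∀ y, (v, y) ∉ M) (hx : ∀ y, (x, y) ∉ M) :
    IsPairing r (Insert.insert (v, x) (Insert.insert (x, v) M)) := by
  refine ⟨fun a b hab => ?_, fun a b c hb hc => ?_⟩
  · simp only [Finset.mem_insert, Prod.mk.injEq] at hab ⊢
    rcases hab with ⟨rfl, rfl⟩ | ⟨rfl, rfl⟩ | hab
    · exact ⟨hvx, by tauto⟩
    · exact ⟨hxv, by tauto⟩
    · have := h.1 a b hab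
      tauto
  · simp only [Finset.mem_insert, Prod.mk.injEq] at hb hc
    rcases hb with ⟨rfl, rfl⟩ | ⟨rfl, rfl⟩ | hb <;> rcases hc with ⟨h1, h2⟩ | ⟨h1, h2⟩ | hc
    · exact h2.symm
    · exact absurd h1 hne
    · exact absurd hc (hv _)
    · exact absurd h1 hne.symm
    · exact h2.symm
    · exact absurd hc (hx _)
    · subst h1; exact absurd hb (hv _)
    · subst h1; exact absurd hb (hx _)
    · exact h.2 a b c hb hc

theorem card_insert [DecidableEq α] {v x : α} (hne : v ≠ x) (hv : ∀ y, (v, y) ∉ M)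
    (hx : ∀ y, (x, y) ∉ M) :
    (Insert.insert (v, x) (Insert.insert (x, v) M)).card = M.card + 2 := by
  rw [Finset.card_insert_of_notMem, Finset.card_insert_of_notMem (hx v)]
  simp only [Finset.mem_insert, Prod.mk.injEq, not_or]
  exact ⟨fun h => hne h.1, hv x⟩

/-- Each vertex of `S` is the first entry of at most one pair and the second entry of at most one.
Since a matching edge counts as two pairs, this is the usual bound of matchings by covers. -/
theorem card_le_two_mul [DecidableEq α] (h : IsPairing r M) (S : Finset α)
    (hS : ∀ a b, r a b → a ∈ S ∨ b ∈ S) : M.card ≤ 2 * S.card := by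
  have h1 : (M.filter fun p => p.1 ∈ S).card ≤ S.card :=
    Finset.card_le_card_of_injOn Prod.fst (fun p hp => (Finset.mem_filter.1 hp).2)
      fun p hp q hq hpq => by
        have hp := (Finset.mem_filter.1 hp).1
        have hq := (Finset.mem_filter.1 hq).1
        obtain ⟨a, b⟩ := p
        obtain ⟨c, d⟩ := q
        obtain rfl : a = c := hpq
        rw [h.2 a b d hp hq]
  have h2 : (M.filter fun p => p.2 ∈ S).card ≤ S.card :=
    Finset.card_le_card_of_injOn Prod.snd (fun p hp => (Finset.mem_filter.1 hp).2)
      fun p hp q hq hpq => by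
        have hp := (Finset.mem_filter.1 hp).1
        have hq := (Finset.mem_filter.1 hq).1
        obtain ⟨a, b⟩ := p
        obtain ⟨c, d⟩ := q
        obtain rfl : b = d := hpq
        rw [h.eq_left hp hq]
  have h3 : M ⊆ (M.filter fun p => p.1 ∈ S) ∪ M.filter fun p => p.2 ∈ S := by
    rintro ⟨a, b⟩ hab
    have := hS a b (h.1 a b hab).1
    simp only [Finset.mem_union, Finset.mem_filter]
    tauto
  have := (Finset.card_le_card h3).trans (Finset.card_union_le _ _)
  omega

theorem image [DecidableEq β] (h : IsPairing r M) {s : β → β → Prop} (f : α → β)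
    (hf : Function.Injective f) (hrs : ∀ a b, r a b → s (f a) (f b)) :
    IsPairing s (M.image (Prod.map f f)) := by
  have key : ∀ x y, (x, y) ∈ M.image (Prod.map f f) → ∃ a b, (a, b) ∈ M ∧ f a = x ∧ f b = y := by
    intro x y hxy
    obtain ⟨⟨a, b⟩, hab, he⟩ := Finset.mem_image.1 hxy
    exact ⟨a, b, hab, (Prod.mk.inj he).1, (Prod.mk.inj he).2⟩
  refine ⟨fun x y hxy => ?_, fun x y z hy hz => ?_⟩
  · obtain ⟨a, b, hab, rfl, rfl⟩ := key x y hxy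
    exact ⟨hrs a b (h.1 a b hab).1, Finset.mem_image.2 ⟨(b, a), (h.1 a b hab).2, rfl⟩⟩
  · obtain ⟨a, b, hab, rfl, rfl⟩ := key x y hy
    obtain ⟨a', c, hac, he, rfl⟩ := key _ z hz
    rw [hf he] at hac
    rw [h.2 a b c hab hac]

/-- If `t` arises from `r` by omitting only edges at vertices that keep more than `m` edges, and
all pairings of `t` have size at most `m`, then so have all pairings of `r`. -/
theorem card_le_of_kernel [DecidableEq α] {m : ℕ} (hr : ∀ a b, r a b → r b a ∧ a ≠ b)
    (ht : ∀ a b, t a b → r a b ∧ t b a)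
    (hker : ∀ a b, r a b → t a b ∨ (∃ X : Finset α, m < X.card ∧ ∀ x ∈ X, t a x) ∨
      ∃ X : Finset α, m < X.card ∧ ∀ x ∈ X, t b x)
    (hm : ∀ M, IsPairing t M → M.card ≤ m) (N : Finset (α × α)) (hN : IsPairing r N) :
    N.card ≤ m := by
  classical
  -- Lexicographic induction on the size and on the number of pairs outside `t`: the outer
  -- hypothesis bounds the pairing with an edge removed, the inner one applies after an exchange.
  suffices H : ∀ n k : ℕ, ∀ N : Finset (α × α), IsPairing r N → N.card = n →
      (N.filter fun p => ¬ t p.1 p.2).card = k → n ≤ m from H _ _ N hN rfl rfl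
  intro n
  induction n using Nat.strong_induction_on with
  | _ n ihn =>
  intro k
  induction k using Nat.strong_induction_on with
  | _ k ihk =>
  intro N hN hn hk
  by_contra hlt
  by_cases hall : ∀ a b, (a, b) ∈ N → t a b
  · exact hlt (hn ▸ hm N (hN.mono hall))
  push Not at hall
  obtain ⟨a, b, hab, htab⟩ := hall
  have main : ∀ v w, (v, w) ∈ N → ¬ t v w → ∀ X : Finset α, m < X.card →
      (∀ x ∈ X, t v x) → False := by
    intro v w hvw htvw X hX hXt
    have hne : v ≠ w := (hr v w (hN.1 v w hvw).1).2
    have hwv := (hN.1 v w hvw).2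
    set N1 := (N.erase (v, w)).erase (w, v) with hN1
    have hP1 : IsPairing r N1 := hN.erase v w
    have hc1 : N1.card + 2 = N.card := by
      have hmem : (w, v) ∈ N.erase (v, w) :=
        Finset.mem_erase.2 ⟨fun h => hne (Prod.mk.inj h).2, hwv⟩
      have h1 := Finset.card_erase_add_one hmem
      have h2 := Finset.card_erase_add_one hvw
      rw [← hN1] at h1
      omega
    have hle := ihn N1.card (by omega) _ N1 hP1 rfl rfl
    have hv1 : ∀ y, (v, y) ∉ N1 := by
      intro y hy
      simp only [hN1, Finset.mem_erase, ne_eq, Prod.mk.injEq] at hy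
      have := hN.2 v y w hy.2.2 hvw
      tauto
    -- `N1` has at most `m` ordered pairs, so it touches at most `m` vertices, fewer than `X` has.
    obtain ⟨x, hxX, hx1⟩ : ∃ x ∈ X, x ∉ N1.image Prod.fst := by
      by_contra hcon
      push Not at hcon
      have := Finset.card_le_card (show X ⊆ N1.image Prod.fst from hcon)
      have := this.trans Finset.card_image_le
      omega
    have hx1 : ∀ y, (x, y) ∉ N1 := fun y hy => hx1 (Finset.mem_image_of_mem Prod.fst hy)
    have htvx := hXt x hxX
    obtain ⟨hvx, htxv⟩ := ht v x htvx
    have hvxne := (hr v x hvx).2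
    -- Trading the edge `v w` for `v x` keeps the size and leaves fewer pairs outside `t`.
    refine (ihk _ ?_ _ (hP1.insert hvx (hr v x hvx).1 hvxne hv1 hx1) ?_ rfl).not_gt (by omega)
    · rw [← hk]
      refine Finset.card_lt_card ⟨fun p hp => ?_, fun hsub => ?_⟩
      · obtain ⟨p1, p2⟩ := p
        simp only [Finset.mem_filter, Finset.mem_insert, Prod.mk.injEq, hN1,
          Finset.mem_erase] at hp ⊢
        obtain ⟨⟨rfl, rfl⟩ | ⟨rfl, rfl⟩ | hp, hp2⟩ := hp
        · exact absurd htvx hp2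
        · exact absurd htxv hp2
        · exact ⟨hp.2.2, hp2⟩
      · have := hsub (Finset.mem_filter.2 ⟨hvw, htvw⟩)
        simp only [Finset.mem_filter, Finset.mem_insert, Prod.mk.injEq] at this
        obtain ⟨⟨-, rfl⟩ | ⟨h, -⟩ | h, -⟩ := this
        · exact htvw htvx
        · exact hvxne h
        · exact hv1 w h
    · rw [card_insert hvxne hv1 hx1]; omega
  rcases hker a b (hN.1 a b hab).1 with h | ⟨X, hX, hXt⟩ | ⟨X, hX, hXt⟩
  · exact htab h
  · exact main a b hab htab X hX hXt
  · exact main b a (hN.1 a b hab).2 (fun h => htab (ht b a h).2) X hX hXt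

end IsPairing

/-! ### Sets of edges of graphs on natural numbers, coded by the pairing function -/

/-- `S` meets every edge whose code is in `X`. -/
def IsCodeCover (X S : Finset ℕ) : Prop := ∀ a b, Nat.pair a b ∈ X → a ∈ S ∨ b ∈ S

theorem IsCodeCover.mono {X Y S : Finset ℕ} (h : IsCodeCover Y S) (hXY : X ⊆ Y) :
    IsCodeCover X S := fun a b hab => h a b (hXY hab)

theorem isCodeCover_image_fst (X : Finset ℕ) :
    IsCodeCover X (X.image fun m => (Nat.unpair m).1) := fun a b hab =>
  Or.inl (Finset.mem_image.2 ⟨_, hab, by simp⟩)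

theorem exists_min_isCodeCover (X : Finset ℕ) :
    ∃ S, IsCodeCover X S ∧ ∀ S', IsCodeCover X S' → S.card ≤ S'.card := by
  classical
  have h : ∃ n, ∃ S, IsCodeCover X S ∧ S.card = n := ⟨_, _, isCodeCover_image_fst X, rfl⟩
  obtain ⟨S, hS, hn⟩ := Nat.find_spec h
  exact ⟨S, hS, fun S' hS' => hn ▸ Nat.find_min' h ⟨S', hS', rfl⟩⟩

/-- A cover of minimum size of the edges with codes in `X`. -/
noncomputable def minCover (X : Finset ℕ) : Finset ℕ := (exists_min_isCodeCover X).choose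

theorem isCodeCover_minCover (X : Finset ℕ) : IsCodeCover X (minCover X) :=
  (exists_min_isCodeCover X).choose_spec.1

theorem card_minCover_le {X S : Finset ℕ} (h : IsCodeCover X S) : (minCover X).card ≤ S.card :=
  (exists_min_isCodeCover X).choose_spec.2 S h

/-- Adjacency in the graph of the edges with codes in `X`. -/
def CodeAdj (X : Finset ℕ) (a b : ℕ) : Prop := Nat.pair a b ∈ X ∨ Nat.pair b a ∈ X

theorem IsPairing.card_le_of_isCodeCover {X S : Finset ℕ} (hS : IsCodeCover X S)
    {M : Finset (ℕ × ℕ)} (hM : IsPairing (CodeAdj X) M) : M.card ≤ 2 * S.card :=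
  hM.card_le_two_mul S fun a b hab => hab.elim (hS a b) fun h => (hS b a h).symm

theorem exists_max_pairing {α : Type} {r : α → α → Prop} {b : ℕ}
    (hb : ∀ M, IsPairing r M → M.card ≤ b) :
    ∃ M, IsPairing r M ∧ ∀ M', IsPairing r M' → M'.card ≤ M.card := by
  classical
  let P : ℕ → Prop := fun n => ∃ M, IsPairing r M ∧ M.card = n
  obtain ⟨M, hM, hn⟩ : P (Nat.findGreatest P b) :=
    Nat.findGreatest_spec (P := P) (Nat.zero_le b) ⟨∅, IsPairing.empty, rfl⟩
  exact ⟨M, hM, fun M' hM' => hn ▸ Nat.le_findGreatest (hb M' hM') ⟨M', hM', rfl⟩⟩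

/-- A maximum matching of the graph of the edges with codes in `X`. -/
noncomputable def maxPairing (X : Finset ℕ) : Finset (ℕ × ℕ) :=
  (exists_max_pairing fun _ => IsPairing.card_le_of_isCodeCover (isCodeCover_minCover X)).choose

theorem isPairing_maxPairing (X : Finset ℕ) : IsPairing (CodeAdj X) (maxPairing X) :=
  (exists_max_pairing fun _ =>
    IsPairing.card_le_of_isCodeCover (isCodeCover_minCover X)).choose_spec.1

theorem card_le_card_maxPairing {X : Finset ℕ} {M : Finset (ℕ × ℕ)}
    (h : IsPairing (CodeAdj X) M) : M.card ≤ (maxPairing X).card :=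
  (exists_max_pairing fun _ =>
    IsPairing.card_le_of_isCodeCover (isCodeCover_minCover X)).choose_spec.2 M h

/-! ### Gossiping -/

/-- The set of the least element of `s`, if there is one. -/
def pick (s : Finset ℕ) : Finset ℕ := s.filter fun m => ∀ k ∈ s, m ≤ k

theorem pick_subset (s : Finset ℕ) : pick s ⊆ s := Finset.filter_subset _ _

theorem pick_eq_singleton {s : Finset ℕ} (h : s.Nonempty) : pick s = {s.min' h} := by
  ext m
  simp only [pick, Finset.mem_filter, Finset.mem_singleton]
  refine ⟨fun hm => le_antisymm (hm.2 _ (s.min'_mem h)) (s.min'_le _ hm.1), ?_⟩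
  rintro rfl
  exact ⟨s.min'_mem h, fun k hk => s.min'_le k hk⟩

/-- The number with binary digits `l`, least significant digit first. -/
def ofBits (l : List Bool) : ℕ := l.foldr (fun b n => Nat.bit b n) 0

theorem ofBits_bits (n : ℕ) : ofBits n.bits = n := by
  induction n using Nat.binaryRec' with
  | zero => simp [ofBits]
  | bit b n h ih =>
    rw [Nat.bits_append_bit _ _ h]
    simp only [ofBits, List.foldr_cons] at ih ⊢
    rw [ih]

theorem ofBits_lt (l : List Bool) : ofBits l < 2 ^ l.length := by
  induction l with
  | nil => simp [ofBits]
  | cons b l ih =>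
    simp only [ofBits, List.foldr_cons, List.length_cons] at ih ⊢
    rw [Nat.bit_val, pow_succ]
    cases b <;> simp <;> omega

/-- The message that announces the least element of `s`. -/
def encode (s : Finset ℕ) : List Bool := if h : s.Nonempty then (s.min' h + 1).bits else []

/-- The set of the announced token. -/
def decode (l : List Bool) : Finset ℕ := if ofBits l = 0 then ∅ else {ofBits l - 1}

/-- The shift by one separates token `0` from the empty message, which announces nothing. -/
theorem decode_encode (s : Finset ℕ) : decode (encode s) = pick s := by
  by_cases h : s.Nonempty
  · simp [decode, encode, h, ofBits_bits, pick_eq_singleton h]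
  · obtain rfl := Finset.not_nonempty_iff_eq_empty.1 h
    simp [decode, encode, ofBits, pick]

theorem length_encode_le {s : Finset ℕ} {b : ℕ} (h : ∀ m ∈ s, (m + 1).size ≤ b) :
    (encode s).length ≤ b := by
  by_cases hs : s.Nonempty
  · simpa [encode, hs, Nat.size_eq_bits_len] using h _ (s.min'_mem hs)
  · simp [encode, hs]

theorem size_of_mem_decode {l : List Bool} {m : ℕ} (h : m ∈ decode l) :
    (m + 1).size ≤ l.length := by
  unfold decode at h
  split_ifs at h with h0
  · simp at h
  · rw [Finset.mem_singleton] at h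
    rw [Nat.size_le, h, Nat.sub_add_cancel (Nat.pos_of_ne_zero h0)]
    exact ofBits_lt l

section Gossip

variable {V : Type} [Fintype V] (G : SimpleGraph V) [DecidableRel G.Adj] (A : V → Finset ℕ)

/-- Starting from the tokens `A v` at every node `v`, in every round every node announces to its
neighbours the least token that it knows and has not announced before.  The sets of known and
announced tokens after `t` rounds. -/
def gossip : ℕ → V → Finset ℕ × Finset ℕ
  | 0, v => (A v, ∅)
  | t + 1, v =>
    ((gossip t v).1 ∪
      (G.neighborFinset v).biUnion fun u => pick ((gossip t u).1 \ (gossip t u).2),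
     (gossip t v).2 ∪ pick ((gossip t v).1 \ (gossip t v).2))

/-- The tokens that start at distance at most `r` from `v` are in `X`. -/
def BallSubset (r : ℕ) (v : V) (X : Finset ℕ) : Prop :=
  ∀ u, (∃ p : G.Walk v u, p.length ≤ r) → A u ⊆ X

variable {G A}

omit [Fintype V] [DecidableRel G.Adj] in
theorem BallSubset.mono {r : ℕ} {v : V} {X Y : Finset ℕ} (h : BallSubset G A r v X)
    (hXY : X ⊆ Y) : BallSubset G A r v Y := fun u hu => (h u hu).trans hXY

theorem gossip_fst_mono (t : ℕ) (v : V) : (gossip G A t v).1 ⊆ (gossip G A (t + 1) v).1 :=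
  Finset.subset_union_left

theorem initial_subset_gossip (t : ℕ) (v : V) : A v ⊆ (gossip G A t v).1 := by
  induction t with
  | zero => exact subset_rfl
  | succ t ih => exact ih.trans (gossip_fst_mono t v)

theorem announced_subset {t : ℕ} {u v : V} (h : G.Adj u v) :
    (gossip G A t u).2 ⊆ (gossip G A t v).1 := by
  induction t with
  | zero => simp [gossip]
  | succ t ih =>
    refine Finset.union_subset (ih.trans (gossip_fst_mono t v)) ?_
    exact (Finset.subset_biUnion_of_mem (fun u => pick ((gossip G A t u).1 \ (gossip G A t u).2))
      ((G.mem_neighborFinset v u).2 h.symm)).trans Finset.subset_union_right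

/-- The engine of pipelining: unless nothing is left to announce, each round announces a new token.
-/
theorem announced_succ (t : ℕ) (v : V) : (gossip G A t v).1 ⊆ (gossip G A (t + 1) v).2 ∨
    (gossip G A t v).2.card + 1 ≤ (gossip G A (t + 1) v).2.card := by
  by_cases h : ((gossip G A t v).1 \ (gossip G A t v).2).Nonempty
  · right
    simp only [gossip]
    rw [pick_eq_singleton h, Finset.union_singleton, Finset.card_insert_of_notMem]
    exact (Finset.mem_sdiff.1 (Finset.min'_mem _ h)).2
  · left
    rw [Finset.not_nonempty_iff_eq_empty, Finset.sdiff_eq_empty_iff_subset] at h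
    exact h.trans Finset.subset_union_left

/-- After `r + s` rounds every node knows the tokens that started at distance at most `r`, or more
than `s` tokens. -/
theorem gossip_progress (r : ℕ) : ∀ s v, BallSubset G A r v (gossip G A (r + s) v).1 ∨
    s + 1 ≤ (gossip G A (r + s) v).1.card := by
  induction r with
  | zero =>
    intro s v
    left
    rintro u ⟨p, hp⟩
    obtain rfl := SimpleGraph.Walk.eq_of_length_eq_zero (Nat.le_zero.1 hp)
    exact initial_subset_gossip _ v
  | succ r ih =>
    -- The same alternative for announced tokens, one round later: a node that has run out of tokens
    -- has announced all it knew, and otherwise its count grows with `s`.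
    have key : ∀ s v, BallSubset G A r v (gossip G A (r + s + 1) v).2 ∨
        s + 1 ≤ (gossip G A (r + s + 1) v).2.card := by
      intro s
      induction s with
      | zero =>
        intro v
        rcases announced_succ (G := G) (A := A) (r + 0) v with h | h
        · exact (ih 0 v).imp (fun h' => h'.mono h) fun h' => h'.trans (Finset.card_le_card h)
        · right; omega
      | succ s ihs =>
        intro v
        rcases announced_succ (G := G) (A := A) (r + (s + 1)) v with h | h
        · exact (ih (s + 1) v).imp (fun h' => h'.mono h)
            fun h' => h'.trans (Finset.card_le_card h)
        · rcases ihs v with h' | h'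
          · exact Or.inl (h'.mono Finset.subset_union_left)
          · right
            rw [← add_assoc] at h ⊢
            omega
    intro s v
    by_cases hc : s + 1 ≤ (gossip G A (r + 1 + s) v).1.card
    · exact Or.inr hc
    -- A node that knows at most `s` tokens has no neighbour that announced `s + 1`, so every
    -- neighbour has announced its whole ball of radius `r`.
    refine Or.inl fun u ⟨p, hp⟩ => ?_
    cases p with
    | nil => exact initial_subset_gossip _ v
    | @cons _ w _ hvw q =>
      have hsub := announced_subset (G := G) (A := A) (t := r + 1 + s) hvw.symm
      rw [SimpleGraph.Walk.length_cons] at hp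
      have hk := key s w
      rw [show r + s + 1 = r + 1 + s by omega] at hk
      rcases hk with h | h
      · exact (h u ⟨q, by omega⟩).trans hsub
      · exact absurd (h.trans (Finset.card_le_card hsub)) hc

theorem gossip_subset (t : ℕ) (v : V) {m : ℕ} (hm : m ∈ (gossip G A t v).1) :
    ∃ u, G.Reachable v u ∧ m ∈ A u := by
  induction t generalizing v with
  | zero => exact ⟨v, SimpleGraph.Reachable.refl v, hm⟩
  | succ t ih =>
    rcases Finset.mem_union.1 hm with h | h
    · exact ih v h
    · obtain ⟨w, hw, hmw⟩ := Finset.mem_biUnion.1 h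
      obtain ⟨u, hu, hmu⟩ := ih w (Finset.mem_sdiff.1 (pick_subset _ hmw)).1
      exact ⟨u, ((G.mem_neighborFinset v w).1 hw).reachable.trans hu, hmu⟩

end Gossip

/-! ### The kernel and its local detection -/

/-- A subset of `s` with `k` elements, if there is one. -/
noncomputable def subsetOfCard (k : ℕ) (s : Finset ℕ) : Finset ℕ :=
  if h : k ≤ s.card then (Finset.exists_subset_card_eq h).choose else ∅

theorem subsetOfCard_subset (k : ℕ) (s : Finset ℕ) : subsetOfCard k s ⊆ s := by
  unfold subsetOfCard
  split_ifs with h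
  · exact (Finset.exists_subset_card_eq h).choose_spec.1
  · exact Finset.empty_subset s

theorem card_subsetOfCard {k : ℕ} {s : Finset ℕ} (h : k ≤ s.card) :
    (subsetOfCard k s).card = k := by
  rw [subsetOfCard, dif_pos h]
  exact (Finset.exists_subset_card_eq h).choose_spec.2

/-- The codes of the edges that a node contributes to the kernel with parameter `d`.  A node of
degree more than `2 * d` contributes `2 * d + 1` of its edges, all other nodes contribute their
edges to neighbours that are not in `high`. -/
noncomputable def kernelTokens (d self : ℕ) (nbrs high : Finset ℕ) : Finset ℕ :=
  (if 2 * d < nbrs.card then subsetOfCard (2 * d + 1) nbrs else nbrs \ high).image (Nat.pair self)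

/-- The edges with codes in `X` are few and have a small vertex cover. -/
def Sparse (d : ℕ) (X : Finset ℕ) : Prop := X.card ≤ 4 * d ^ 2 + d ∧ (minCover X).card ≤ d

theorem Sparse.mono {d : ℕ} {X Y : Finset ℕ} (h : Sparse d Y) (hXY : X ⊆ Y) : Sparse d X :=
  ⟨(Finset.card_le_card hXY).trans h.1,
    (card_minCover_le ((isCodeCover_minCover Y).mono hXY)).trans h.2⟩

/-- The number of rounds of gossiping in a phase with parameter `d`. -/
def gossipTime (d : ℕ) : ℕ := 2 * d + 1 + (4 * d ^ 2 + d)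

section Kernel

variable {V : Type} [Fintype V] (G : SimpleGraph V) [DecidableRel G.Adj] (id : V → ℕ) (d : ℕ)

/-- The edges that node `v` contributes to the kernel. -/
noncomputable def startTokens (v : V) : Finset ℕ :=
  kernelTokens d (id v) ((G.neighborFinset v).image id)
    (((G.neighborFinset v).filter fun u => 2 * d < G.degree u).image id)

open Classical in
/-- The kernel of the connected component of `v`. -/
noncomputable def componentTokens (v : V) : Finset ℕ :=
  (Finset.univ.filter (G.Reachable v)).biUnion (startTokens G id d)

/-- The tokens that `v` knows at the end of a phase. -/
noncomputable def finalTokens (v : V) : Finset ℕ :=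
  (gossip G (startTokens G id d) (gossipTime d) v).1

variable {G id d}

theorem mem_componentTokens {v : V} {m : ℕ} :
    m ∈ componentTokens G id d v ↔ ∃ u, G.Reachable v u ∧ m ∈ startTokens G id d u := by
  simp [componentTokens]

theorem componentTokens_eq {u v : V} (h : G.Reachable u v) :
    componentTokens G id d u = componentTokens G id d v := by
  ext m
  simp only [mem_componentTokens]
  exact ⟨fun ⟨w, hw, hm⟩ => ⟨w, h.symm.trans hw, hm⟩, fun ⟨w, hw, hm⟩ => ⟨w, h.trans hw, hm⟩⟩

theorem exists_of_mem_startTokens {v : V} {m : ℕ} (h : m ∈ startTokens G id d v) :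
    ∃ u, G.Adj v u ∧ m = Nat.pair (id v) (id u) := by
  obtain ⟨a, ha, rfl⟩ := Finset.mem_image.1 h
  have : a ∈ (G.neighborFinset v).image id := by
    split_ifs at ha
    · exact subsetOfCard_subset _ _ ha
    · exact (Finset.mem_sdiff.1 ha).1
  obtain ⟨u, hu, rfl⟩ := Finset.mem_image.1 this
  exact ⟨u, (G.mem_neighborFinset v u).1 hu, rfl⟩

variable (hid : Function.Injective id)
include hid

theorem card_image_neighborFinset (v : V) : ((G.neighborFinset v).image id).card = G.degree v := by
  rw [Finset.card_image_of_injective _ hid, G.card_neighborFinset_eq_degree]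

omit hid in
theorem card_startTokens_le (v : V) : (startTokens G id d v).card ≤ 2 * d + 1 := by
  refine Finset.card_image_le.trans ?_
  split_ifs with h
  · exact (card_subsetOfCard (k := 2 * d + 1) h).le
  · exact (Finset.card_le_card Finset.sdiff_subset).trans (by omega)

theorem exists_of_degree_gt {v : V} (hv : 2 * d < G.degree v) :
    ∃ X : Finset V, X.card = 2 * d + 1 ∧
      ∀ x ∈ X, Nat.pair (id v) (id x) ∈ startTokens G id d v := by
  classical
  have hc : 2 * d < ((G.neighborFinset v).image id).card := by
    rwa [card_image_neighborFinset hid]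
  refine ⟨(G.neighborFinset v).filter fun x =>
    id x ∈ subsetOfCard (2 * d + 1) ((G.neighborFinset v).image id), ?_, fun x hx => ?_⟩
  · rw [← Finset.card_image_of_injective _ hid]
    refine (congrArg Finset.card ?_).trans (card_subsetOfCard (k := 2 * d + 1) hc)
    ext a
    simp only [Finset.mem_image, Finset.mem_filter]
    constructor
    · rintro ⟨x, ⟨-, hx⟩, rfl⟩
      exact hx
    · intro ha
      obtain ⟨x, hx, rfl⟩ := Finset.mem_image.1 (subsetOfCard_subset _ _ ha)
      exact ⟨x, ⟨hx, ha⟩, rfl⟩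
  · refine Finset.mem_image_of_mem _ ?_
    rw [if_pos hc]
    exact (Finset.mem_filter.1 hx).2

theorem mem_startTokens_of_degree_le {u v : V} (hv : G.degree v ≤ 2 * d) :
    Nat.pair (id v) (id u) ∈ startTokens G id d v ↔ G.Adj v u ∧ G.degree u ≤ 2 * d := by
  have hc : ¬ 2 * d < ((G.neighborFinset v).image id).card := by
    rwa [card_image_neighborFinset hid, not_lt]
  simp only [startTokens, kernelTokens, if_neg hc, Finset.mem_image, Finset.mem_sdiff,
    Finset.mem_filter, SimpleGraph.mem_neighborFinset]
  constructor
  · rintro ⟨a, ⟨⟨x, hx, rfl⟩, hn⟩, he⟩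
    obtain rfl := hid (Nat.pair_eq_pair.1 he).2
    exact ⟨hx, not_lt.1 fun h => hn ⟨x, ⟨hx, h⟩, rfl⟩⟩
  · rintro ⟨h1, h2⟩
    refine ⟨id u, ⟨⟨u, h1, rfl⟩, ?_⟩, rfl⟩
    rintro ⟨x, ⟨-, hx⟩, he⟩
    rw [hid he] at hx
    omega

/-- A small cover of the kernel covers all edges of the network. -/
theorem cover_of_cover_kernel {X : Finset ℕ} {S : Finset V} (hcard : S.card ≤ 2 * d)
    (hS : ∀ x y, Nat.pair (id x) (id y) ∈ X → x ∈ S ∨ y ∈ S) {x y : V} (hxy : G.Adj x y)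
    (hx : startTokens G id d x ⊆ X) (hy : startTokens G id d y ⊆ X) : x ∈ S ∨ y ∈ S := by
  have high : ∀ z, startTokens G id d z ⊆ X → 2 * d < G.degree z → z ∈ S := by
    intro z hz hdeg
    obtain ⟨Y, hY, hYt⟩ := exists_of_degree_gt hid hdeg
    -- A high-degree vertex outside `S` would force its `2 * d + 1` kernel neighbours into `S`.
    by_contra hzS
    have : Y ⊆ S := fun w hw => (hS z w (hz (hYt w hw))).resolve_left hzS
    have := Finset.card_le_card this
    omega
  by_cases h1 : 2 * d < G.degree x
  · exact Or.inl (high x hx h1)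
  by_cases h2 : 2 * d < G.degree y
  · exact Or.inr (high y hy h2)
  rw [not_lt] at h1 h2
  exact hS x y (hx ((mem_startTokens_of_degree_le hid h1).2 ⟨hxy, h2⟩))

omit [Fintype V] [DecidableRel G.Adj] hid in
theorem dist_getVert {u v : V} (p : G.Walk v u) (hp : p.length = G.dist v u) {i : ℕ}
    (hi : i ≤ p.length) : G.dist v (p.getVert i) = i := by
  have h1 : G.dist v (p.getVert i) ≤ i :=
    (SimpleGraph.dist_le (p.take i)).trans (by simp)
  have h2 : G.dist (p.getVert i) u ≤ p.length - i :=
    (SimpleGraph.dist_le (p.drop i)).trans (by simp)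
  have h3 := (p.take i).reachable.dist_triangle_left u
  omega

omit [DecidableRel G.Adj] in
theorem card_filter_id_le (S : Finset ℕ) : (Finset.univ.filter fun u => id u ∈ S).card ≤ S.card :=
  Finset.card_le_card_of_injOn id (fun _ hu => (Finset.mem_filter.1 hu).2) hid.injOn

/-- A node that ends up with a sparse set of tokens knows the kernel of its whole component. -/
theorem finalTokens_eq_of_sparse {v : V} (h : Sparse d (finalTokens G id d v)) :
    finalTokens G id d v = componentTokens G id d v := by
  set X := finalTokens G id d v with hX
  -- `gossipTime d` is `r + s` with `r = 2 * d + 1` and `s = 4 * d ^ 2 + d`; sparsity excludes more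
  -- than `s` tokens.
  have hball : BallSubset G (startTokens G id d) (2 * d + 1) v X :=
    (gossip_progress (2 * d + 1) (4 * d ^ 2 + d) v).resolve_right (not_le.2 (Nat.lt_succ_of_le h.1))
  refine Finset.Subset.antisymm (fun m hm => mem_componentTokens.2 (gossip_subset _ _ hm)) ?_
  intro m hm
  obtain ⟨u, hvu, hmu⟩ := mem_componentTokens.1 hm
  by_contra hmX
  obtain ⟨p, hp⟩ := hvu.exists_walk_length_eq_dist
  have hlen : 2 * d + 1 < p.length := by
    by_contra hle
    exact hmX (hball u ⟨p, not_lt.1 hle⟩ hmu)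
  let S : Finset V := Finset.univ.filter fun u => id u ∈ minCover X
  have hSc : S.card ≤ d := (card_filter_id_le hid _).trans h.2
  have hS : ∀ x y, Nat.pair (id x) (id y) ∈ X → x ∈ S ∨ y ∈ S := fun x y hxy => by
    simpa [S] using isCodeCover_minCover X _ _ hxy
  have hin : ∀ i ≤ 2 * d + 1, startTokens G id d (p.getVert i) ⊆ X := fun i hi =>
    hball _ ⟨p.take i, by simp; omega⟩
  -- The path edges joining distances `2 * j` and `2 * j + 1`, for `j ≤ d`, need not lie in the
  -- kernel, but `S` covers them all. Halving the distance recovers `j`, so `S` has at least `d + 1`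
  -- vertices.
  have hsub : Finset.range (d + 1) ⊆ S.image fun x => G.dist v x / 2 := by
    intro j hj
    rw [Finset.mem_range] at hj
    have hd0 := dist_getVert p hp (i := 2 * j) (by omega)
    have hd1 := dist_getVert p hp (i := 2 * j + 1) (by omega)
    rcases cover_of_cover_kernel hid (by omega) hS (p.adj_getVert_succ (i := 2 * j) (by omega))
      (hin _ (by omega)) (hin _ (by omega)) with h | h
    · exact Finset.mem_image.2 ⟨_, h, by omega⟩
    · exact Finset.mem_image.2 ⟨_, h, by omega⟩
  have := (Finset.card_le_card hsub).trans Finset.card_image_le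
  rw [Finset.card_range] at this
  omega

/-- Turns the local halting test into a property of the component, so that its nodes decide alike
without further communication. -/
theorem sparse_iff (v : V) :
    Sparse d (finalTokens G id d v) ↔ Sparse d (componentTokens G id d v) :=
  ⟨fun h => finalTokens_eq_of_sparse hid h ▸ h,
    fun h => h.mono fun _ hm => mem_componentTokens.2 (gossip_subset _ _ hm)⟩

omit hid in
theorem isCodeCover_image {v : V} {C : Finset V}
    (hC : ∀ x y, G.Reachable v x → G.Adj x y → x ∈ C ∨ y ∈ C) :
    IsCodeCover (componentTokens G id d v) (C.image id) := by
  intro a b hab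
  obtain ⟨x, hx, hm⟩ := mem_componentTokens.1 hab
  obtain ⟨y, hxy, he⟩ := exists_of_mem_startTokens hm
  obtain ⟨rfl, rfl⟩ := Nat.pair_eq_pair.1 he
  exact (hC x y hx hxy).imp (Finset.mem_image_of_mem id) (Finset.mem_image_of_mem id)

/-- If the network has a vertex cover of size at most `d`, then all kernels are sparse. -/
theorem sparse_componentTokens (v : V) {C : Finset V} (hC : ∀ x y, G.Adj x y → x ∈ C ∨ y ∈ C)
    (hd : C.card ≤ d) : Sparse d (componentTokens G id d v) := by
  classical
  refine ⟨?_, (card_minCover_le (isCodeCover_image fun x y _ => hC x y)).trans (Finset.card_image_le.trans hd)⟩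
  have hhigh : ∀ x, x ∉ C → G.degree x ≤ 2 * d := by
    intro x hx
    have : G.neighborFinset x ⊆ C := fun y hy =>
      (hC x y ((G.mem_neighborFinset x y).1 hy)).resolve_left hx
    have := Finset.card_le_card this
    rw [G.card_neighborFinset_eq_degree] at this
    omega
  -- A token from a node outside `C` joins two low-degree nodes and is charged to its end in `C`.
  -- The total is at most `d * (2 * d + 1) + d * (2 * d)`.
  have hsub : componentTokens G id d v ⊆ C.biUnion (startTokens G id d) ∪
      (C.filter fun y => G.degree y ≤ 2 * d).biUnion
        fun y => (G.neighborFinset y).image fun x => Nat.pair (id x) (id y) := by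
    intro m hm
    obtain ⟨x, -, hm⟩ := mem_componentTokens.1 hm
    obtain ⟨y, hxy, rfl⟩ := exists_of_mem_startTokens hm
    by_cases hx : x ∈ C
    · exact Finset.mem_union_left _ (Finset.mem_biUnion.2 ⟨x, hx, hm⟩)
    · refine Finset.mem_union_right _ (Finset.mem_biUnion.2 ⟨y, Finset.mem_filter.2
        ⟨(hC x y hxy).resolve_left hx, ?_⟩, ?_⟩)
      · exact ((mem_startTokens_of_degree_le hid (hhigh x hx)).1 hm).2
      · exact Finset.mem_image.2 ⟨x, (G.mem_neighborFinset y x).2 hxy.symm, rfl⟩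
  refine (Finset.card_le_card hsub).trans ((Finset.card_union_le _ _).trans ?_)
  have h1 : (C.biUnion (startTokens G id d)).card ≤ C.card * (2 * d + 1) :=
    Finset.card_biUnion_le_card_mul _ _ _ fun x _ => card_startTokens_le x
  have h2 : ((C.filter fun y => G.degree y ≤ 2 * d).biUnion
      fun y => (G.neighborFinset y).image fun x => Nat.pair (id x) (id y)).card ≤
      (C.filter fun y => G.degree y ≤ 2 * d).card * (2 * d) :=
    Finset.card_biUnion_le_card_mul _ _ _ fun y hy => Finset.card_image_le.trans (by
      rw [G.card_neighborFinset_eq_degree]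
      exact (Finset.mem_filter.1 hy).2)
  have h3 : (C.filter fun y => G.degree y ≤ 2 * d).card ≤ d :=
    (Finset.card_filter_le _ _).trans hd
  nlinarith [Nat.mul_le_mul_right (2 * d + 1) hd, Nat.mul_le_mul_right (2 * d) h3]

end Kernel

/-! ### The algorithm and its phases -/

/-- The memory of a node in the algorithm below. -/
structure NodeState where
  self : ℕ
  nbrs : Finset ℕ
  phase : ℕ
  step : ℕ
  known : Finset ℕ
  sent : Finset ℕ

open Classical in
/-- In phase `i` the kernel with parameter `2 ^ i` is spread by gossiping.  A node that ends up with
a sparse kernel computes its output from it, all others proceed to the next phase. -/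
noncomputable def kernelAlgorithm {O : Type} (f : ℕ → Finset ℕ → O) : DistAlgorithm O where
  State := NodeState
  init _ self nbrs := ⟨self, nbrs, 0, 0, ∅, ∅⟩
  send s _ :=
    if s.step = 0 then (if 2 * 2 ^ s.phase < s.nbrs.card then [true] else [])
    else encode (s.known \ s.sent)
  receive s inbox :=
    if s.step = 0 then
      ⟨s.self, s.nbrs, s.phase, 1, kernelTokens (2 ^ s.phase) s.self s.nbrs
        ((inbox.filter fun p => p.2 = [true]).image Prod.fst), ∅⟩
    else if s.step ≤ gossipTime (2 ^ s.phase) then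
      ⟨s.self, s.nbrs, s.phase, s.step + 1, s.known ∪ inbox.biUnion fun p => decode p.2,
        s.sent ∪ pick (s.known \ s.sent)⟩
    else ⟨s.self, s.nbrs, s.phase + 1, 0, ∅, ∅⟩
  output s :=
    if s.nbrs = ∅ then some (f s.self ∅)
    else if s.step = gossipTime (2 ^ s.phase) + 1 ∧ Sparse (2 ^ s.phase) s.known then
      some (f s.self s.known)
    else none

/-- The number of rounds before phase `i`. -/
def phaseStart : ℕ → ℕ
  | 0 => 0
  | i + 1 => phaseStart i + gossipTime (2 ^ i) + 2

theorem phaseStart_mono : Monotone phaseStart :=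
  monotone_nat_of_le_succ fun i => by rw [phaseStart]; omega

/-- Phase `i` takes `4 * 4 ^ i + 3 * 2 ^ i + 3 ≤ 10 * 4 ^ i` rounds, while the bound grows by `12 *
4 ^ i`. -/
theorem phaseStart_le (i : ℕ) : phaseStart i ≤ 4 * 4 ^ i := by
  induction i with
  | zero => simp [phaseStart]
  | succ i ih =>
    have h1 : (2 ^ i) ^ 2 = 4 ^ i := by rw [← pow_mul, mul_comm, pow_mul]; norm_num
    have h2 := Nat.one_le_two_pow (n := i)
    rw [phaseStart, gossipTime, h1]
    rw [pow_succ]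
    nlinarith

/-! ### Execution, message lengths and running time -/

section Run

variable {V O : Type} [Fintype V] (G : SimpleGraph V) [DecidableRel G.Adj] (id : V → ℕ)
  (f : ℕ → Finset ℕ → O)

/-- The state of an unhalted node at step `s` of phase `i`. -/
noncomputable def phaseState (i : ℕ) : ℕ → V → NodeState
  | 0, v => ⟨id v, (G.neighborFinset v).image id, i, 0, ∅, ∅⟩
  | s + 1, v => ⟨id v, (G.neighborFinset v).image id, i, s + 1,
      (gossip G (startTokens G id (2 ^ i)) s v).1, (gossip G (startTokens G id (2 ^ i)) s v).2⟩

/-- The phase in which the component of `v` is solved. -/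
noncomputable def solvingPhase (v : V) : ℕ :=
  sInf {i | Sparse (2 ^ i) (componentTokens G id (2 ^ i) v)}

variable {G id}

theorem solvingPhase_eq {u v : V} (h : G.Reachable u v) :
    solvingPhase G id u = solvingPhase G id v := by
  simp only [solvingPhase, componentTokens_eq h]

theorem solvingPhase_le (hid : Function.Injective id) (v : V) {C : Finset V} {k : ℕ}
    (hC : ∀ x y, G.Adj x y → x ∈ C ∨ y ∈ C) (hk : C.card ≤ 2 ^ k) : solvingPhase G id v ≤ k :=
  Nat.sInf_le (sparse_componentTokens hid v hC hk)

/-- Some phase succeeds: for `d = 2 ^ n ≥ n` the whole vertex set is a small enough cover. -/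
theorem sparse_solvingPhase (hid : Function.Injective id) (v : V) :
    Sparse (2 ^ solvingPhase G id v) (componentTokens G id (2 ^ solvingPhase G id v) v) :=
  Nat.sInf_mem (s := {i | Sparse (2 ^ i) (componentTokens G id (2 ^ i) v)})
    ⟨Fintype.card V, sparse_componentTokens hid v (C := Finset.univ) (by simp)
      (by rw [Finset.card_univ]; exact Nat.lt_two_pow_self.le)⟩

theorem image_neighborFinset_ne_empty {u v : V} (h : G.Adj v u) :
    (G.neighborFinset v).image id ≠ ∅ :=
  Finset.nonempty_iff_ne_empty.1 ⟨id u, Finset.mem_image_of_mem _ ((G.mem_neighborFinset v u).2 h)⟩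

variable {f}

theorem output_phaseState_eq_none (hid : Function.Injective id) {u v : V} (h : G.Adj v u) {i s : ℕ}
    (hs : s ≤ gossipTime (2 ^ i) ∨ ¬ Sparse (2 ^ i) (componentTokens G id (2 ^ i) v))
    (hle : s ≤ gossipTime (2 ^ i) + 1) :
    (kernelAlgorithm f).output (phaseState G id i s v) = none := by
  have hne := image_neighborFinset_ne_empty (id := id) h
  cases s with
  | zero => simp [kernelAlgorithm, phaseState, hne]
  | succ s =>
    simp only [kernelAlgorithm, phaseState, if_neg hne]
    refine if_neg fun hcon => ?_
    rcases hs with hs | hs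
    · omega
    · obtain rfl : s = gossipTime (2 ^ i) := by omega
      exact hs ((sparse_iff hid v).1 hcon.2)

theorem output_phaseState_last (hid : Function.Injective id) {u v : V} (h : G.Adj v u) {i : ℕ}
    (hs : Sparse (2 ^ i) (componentTokens G id (2 ^ i) v)) :
    (kernelAlgorithm f).output (phaseState G id i (gossipTime (2 ^ i) + 1) v) =
      some (f (id v) (componentTokens G id (2 ^ i) v)) := by
  have hne := image_neighborFinset_ne_empty (id := id) h
  have h1 := (sparse_iff hid v).2 hs
  have h2 := finalTokens_eq_of_sparse hid h1
  unfold finalTokens at h1 h2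
  simp only [kernelAlgorithm, phaseState, if_neg hne]
  rw [if_pos ⟨rfl, h1⟩, h2]

/-- The state of a node after a round in which neither it nor any of its neighbours has halted. -/
theorem stateAfter_succ_of_phaseState (hid : Function.Injective id) {v : V} {i s t : ℕ}
    (hout : ∀ u, u = v ∨ G.Adj v u → (kernelAlgorithm f).output (phaseState G id i s u) = none)
    (hst : ∀ u, u = v ∨ G.Adj v u →
      (kernelAlgorithm f).stateAfter G id t u = phaseState G id i s u) :
    (kernelAlgorithm f).stateAfter G id (t + 1) v =
      if s ≤ gossipTime (2 ^ i) then phaseState G id i (s + 1) v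
      else phaseState G id (i + 1) 0 v := by
  have hin : ((G.neighborFinset v).image fun u =>
      (id u, (kernelAlgorithm f).message ((kernelAlgorithm f).stateAfter G id t u) (id v))) =
      (G.neighborFinset v).image fun u =>
        (id u, (kernelAlgorithm f).send (phaseState G id i s u) (id v)) := by
    refine Finset.image_congr fun u hu => ?_
    have hu' : u = v ∨ G.Adj v u := Or.inr ((G.mem_neighborFinset v u).1 hu)
    simp only [DistAlgorithm.message, hst u hu', hout u hu', Option.isSome_none]
    rfl
  rw [DistAlgorithm.stateAfter, hin, hst v (Or.inl rfl), hout v (Or.inl rfl)]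
  cases s with
  | zero =>
    simp only [Option.isSome_none, Bool.false_eq_true, if_false, phaseState, kernelAlgorithm,
      if_true, Nat.zero_le, gossip, startTokens, zero_add]
    congr 2
    ext a
    simp only [Finset.mem_image, Finset.mem_filter, card_image_neighborFinset hid]
    constructor
    · rintro ⟨_, ⟨⟨u, hu, rfl⟩, h⟩, rfl⟩
      refine ⟨u, ⟨hu, ?_⟩, rfl⟩
      by_contra hlt
      simp [hlt] at h
    · rintro ⟨u, ⟨hu, h⟩, rfl⟩
      exact ⟨_, ⟨⟨u, hu, rfl⟩, by simp [h]⟩, rfl⟩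
  | succ s =>
    simp only [Option.isSome_none, Bool.false_eq_true, if_false, phaseState, kernelAlgorithm,
      Nat.add_eq_zero_iff, one_ne_zero, and_false, gossip]
    split_ifs
    · congr 2
      rw [Finset.image_biUnion]
      simp only [decode_encode]
    · rfl

/-- A halted node is silent and could spoil the gossip of others. Since `solvingPhase` is constant
on components, no neighbour halts before the last step of the solving phase. The neighbour `u` rules
out isolated nodes, which halt at time `0`. -/
theorem stateAfter_phaseStart_add (hid : Function.Injective id) (i : ℕ) :
    ∀ s ≤ gossipTime (2 ^ i) + 1, ∀ v u, G.Adj v u → i ≤ solvingPhase G id v →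
      (kernelAlgorithm f).stateAfter G id (phaseStart i + s) v = phaseState G id i s v := by
  have hadj : ∀ {v u w : V}, G.Adj v u → w = v ∨ G.Adj v w →
      (∃ x, G.Adj w x) ∧ solvingPhase G id w = solvingPhase G id v := by
    rintro v u w hvu (rfl | hw)
    · exact ⟨⟨u, hvu⟩, rfl⟩
    · exact ⟨⟨v, hw.symm⟩, solvingPhase_eq hw.symm.reachable⟩
  induction i with
  | zero =>
    intro s
    induction s with
    | zero => exact fun _ v u _ _ => rfl
    | succ s ih =>
      intro hs v u hvu hv
      rw [← add_assoc, stateAfter_succ_of_phaseState hid (i := 0) (s := s), if_pos (by omega)]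
      · intro w hw
        obtain ⟨⟨x, hx⟩, he⟩ := hadj hvu hw
        exact output_phaseState_eq_none hid hx (Or.inl (by omega)) (by omega)
      · intro w hw
        obtain ⟨⟨x, hx⟩, he⟩ := hadj hvu hw
        exact ih (by omega) w x hx (he ▸ hv)
  | succ i ihi =>
    intro s
    induction s with
    | zero =>
      intro _ v u hvu hv
      -- The round after the halting test only moves on to the next phase; its messages are
      -- discarded.
      rw [add_zero, phaseStart, show phaseStart i + gossipTime (2 ^ i) + 2 =
        phaseStart i + (gossipTime (2 ^ i) + 1) + 1 by omega,
        stateAfter_succ_of_phaseState hid (i := i) (s := gossipTime (2 ^ i) + 1),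
        if_neg (by omega)]
      · intro w hw
        obtain ⟨⟨x, hx⟩, he⟩ := hadj hvu hw
        refine output_phaseState_eq_none hid hx (Or.inr fun hsp => ?_) le_rfl
        have : solvingPhase G id w ≤ i := Nat.sInf_le hsp
        omega
      · intro w hw
        obtain ⟨⟨x, hx⟩, he⟩ := hadj hvu hw
        exact ihi _ le_rfl w x hx (by omega)
    | succ s ih =>
      intro hs v u hvu hv
      rw [← add_assoc, stateAfter_succ_of_phaseState hid (i := i + 1) (s := s),
        if_pos (by omega)]
      · intro w hw
        obtain ⟨⟨x, hx⟩, he⟩ := hadj hvu hw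
        exact output_phaseState_eq_none hid hx (Or.inl (by omega)) (by omega)
      · intro w hw
        obtain ⟨⟨x, hx⟩, he⟩ := hadj hvu hw
        exact ih (by omega) w x hx (he ▸ hv)

theorem DistAlgorithm.output_stateAfter_of_le (A : DistAlgorithm O) {v : V} {t t' : ℕ} {o : O}
    (h : A.output (A.stateAfter G id t v) = some o) (htt' : t ≤ t') :
    A.output (A.stateAfter G id t' v) = some o := by
  induction t', htt' using Nat.le_induction with
  | base => exact h
  | succ n _ ih =>
    rw [DistAlgorithm.stateAfter, if_pos (by simp [ih])]
    exact ih

theorem output_stateAfter (hid : Function.Injective id) (v : V) (T : ℕ)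
    (hT : ∀ u, G.Adj v u → phaseStart (solvingPhase G id v + 1) ≤ T) :
    (kernelAlgorithm f).output ((kernelAlgorithm f).stateAfter G id T v) =
      some (f (id v) (componentTokens G id (2 ^ solvingPhase G id v) v)) := by
  by_cases h : ∃ u, G.Adj v u
  · obtain ⟨u, hu⟩ := h
    refine DistAlgorithm.output_stateAfter_of_le _
      (t := phaseStart (solvingPhase G id v) + (gossipTime (2 ^ solvingPhase G id v) + 1)) ?_ ?_
    · rw [stateAfter_phaseStart_add hid _ _ le_rfl v u hu le_rfl]
      exact output_phaseState_last hid hu (sparse_solvingPhase hid v)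
    · have := hT u hu
      rw [phaseStart] at this
      omega
  · push Not at h
    have hN : G.neighborFinset v = ∅ := by
      ext u
      simpa using h u
    -- An isolated node halts at once with the empty token set, which is indeed its kernel.
    have hX : componentTokens G id (2 ^ solvingPhase G id v) v = ∅ := by
      refine Finset.eq_empty_of_forall_notMem fun m hm => ?_
      obtain ⟨u, ⟨p⟩, hm⟩ := mem_componentTokens.1 hm
      obtain ⟨w, huw, -⟩ := exists_of_mem_startTokens hm
      cases p with
      | nil => exact h w huw
      | cons hadj _ => exact h _ hadj
    refine DistAlgorithm.output_stateAfter_of_le _ (t := 0) ?_ (Nat.zero_le T)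
    rw [hX]
    simp [DistAlgorithm.stateAfter, kernelAlgorithm, hN]

/-- All tokens in circulation are codes of pairs of identifiers. -/
theorem stateAfter_known {b : ℕ} (hb : ∀ u v, (Nat.pair (id u) (id v) + 1).size ≤ b) (t : ℕ) :
    ∀ v, ((kernelAlgorithm f).stateAfter G id t v).self = id v ∧
      ((kernelAlgorithm f).stateAfter G id t v).nbrs = (G.neighborFinset v).image id ∧
      (∀ m ∈ ((kernelAlgorithm f).stateAfter G id t v).known, (m + 1).size ≤ b) ∧
      ∀ j, ((kernelAlgorithm f).message ((kernelAlgorithm f).stateAfter G id t v) j).length ≤ b := by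
  have hmsg : ∀ s : NodeState, ∀ v : V, (∀ m ∈ s.known, (m + 1).size ≤ b) →
      ∀ j, ((kernelAlgorithm f).message s j).length ≤ b := by
    intro s v hs j
    have h1 : 1 ≤ b := (Nat.size_pos.2 (Nat.succ_pos _)).trans_le (hb v v)
    simp only [DistAlgorithm.message]
    split_ifs
    · exact Nat.zero_le b
    simp only [kernelAlgorithm]
    split_ifs
    · exact h1
    · exact Nat.zero_le b
    · exact length_encode_le fun m hm => hs m (Finset.mem_sdiff.1 hm).1
  induction t with
  | zero =>
    refine fun v => ⟨rfl, rfl, ?_, hmsg _ v ?_⟩ <;>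
    · intro m hm
      exact absurd hm (Finset.notMem_empty m)
  | succ t ih =>
    intro v
    suffices H : ((kernelAlgorithm f).stateAfter G id (t + 1) v).self = id v ∧
        ((kernelAlgorithm f).stateAfter G id (t + 1) v).nbrs = (G.neighborFinset v).image id ∧
        (∀ m ∈ ((kernelAlgorithm f).stateAfter G id (t + 1) v).known, (m + 1).size ≤ b) from
      ⟨H.1, H.2.1, H.2.2, hmsg _ v H.2.2⟩
    obtain ⟨h1, h2, h3, -⟩ := ih v
    have h4 : ∀ p ∈ ((G.neighborFinset v).image fun u => (id u,
        (kernelAlgorithm f).message ((kernelAlgorithm f).stateAfter G id t u) (id v))),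
        p.2.length ≤ b := by
      intro p hp
      obtain ⟨u, -, rfl⟩ := Finset.mem_image.1 hp
      exact (ih u).2.2.2 _
    rw [DistAlgorithm.stateAfter]
    generalize ((G.neighborFinset v).image fun u => (id u,
        (kernelAlgorithm f).message ((kernelAlgorithm f).stateAfter G id t u) (id v))) = inbox at h4
    generalize (kernelAlgorithm f).stateAfter G id t v = s at h1 h2 h3
    split_ifs
    · exact ⟨h1, h2, h3⟩
    · simp only [kernelAlgorithm]
      split_ifs
      · refine ⟨h1, h2, fun m hm => ?_⟩
        obtain ⟨a, ha, rfl⟩ := Finset.mem_image.1 hm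
        have ha : a ∈ s.nbrs := by
          split_ifs at ha
          · exact subsetOfCard_subset _ _ ha
          · exact (Finset.mem_sdiff.1 ha).1
        rw [h2] at ha
        obtain ⟨u, -, rfl⟩ := Finset.mem_image.1 ha
        rw [h1]
        exact hb v u
      · refine ⟨h1, h2, fun m hm => ?_⟩
        rcases Finset.mem_union.1 hm with hm | hm
        · exact h3 m hm
        · obtain ⟨p, hp, hm⟩ := Finset.mem_biUnion.1 hm
          exact (size_of_mem_decode hm).trans (h4 p hp)
      · exact ⟨h1, h2, by simp⟩

theorem size_pair_succ_le {c n a b : ℕ} (hn : 0 < n) (ha : a.size ≤ c * n.size)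
    (hb : b.size ≤ c * n.size) : (Nat.pair a b + 1).size ≤ (2 * c + 1) * n.size := by
  rw [Nat.size_le] at ha hb ⊢
  have hmax : max a b + 1 ≤ 2 ^ (c * n.size) := max_lt ha hb
  have h1 : Nat.pair a b + 1 ≤ 2 ^ (2 * (c * n.size)) :=
    calc Nat.pair a b + 1 ≤ (max a b + 1) ^ 2 := Nat.pair_lt_max_add_one_sq a b
      _ ≤ (2 ^ (c * n.size)) ^ 2 := Nat.pow_le_pow_left hmax 2
      _ = 2 ^ (2 * (c * n.size)) := by rw [← pow_mul, mul_comm]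
  refine h1.trans_lt (Nat.pow_lt_pow_right one_lt_two ?_)
  have := Nat.size_pos.2 hn
  nlinarith

/-- The algorithm halts within `O(k ^ 2)` rounds if there is a vertex cover of size at most `k`. -/
theorem kernelAlgorithm_computes {c : ℕ} (hid : ValidIds c id) {C : Finset V}
    (hC : ∀ x y, G.Adj x y → x ∈ C ∨ y ∈ C) :
    ∃ T ≤ 64 * C.card ^ 2, (kernelAlgorithm f).Computes G id
      ((2 * c + 1) * (Fintype.card V).size) T
      fun v => f (id v) (componentTokens G id (2 ^ solvingPhase G id v) v) := by
  have hb : ∀ (t : ℕ) (u v : V), G.Adj u v →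
      ((kernelAlgorithm f).message ((kernelAlgorithm f).stateAfter G id t u) (id v)).length ≤
        (2 * c + 1) * (Fintype.card V).size := fun t u v _ =>
    (stateAfter_known (fun x y => size_pair_succ_le (Fintype.card_pos_iff.2 ⟨x⟩)
      (hid.2 x) (hid.2 y)) t u).2.2.2 (id v)
  by_cases h0 : C.card = 0
  · refine ⟨0, Nat.zero_le _, hb, fun v => output_stateAfter hid.1 v 0 fun u hu => ?_⟩
    have := hC v u hu
    simp [Finset.card_eq_zero.1 h0] at this
  · obtain ⟨k, hk1, hk2⟩ : ∃ k, C.card ≤ 2 ^ k ∧ 2 ^ k ≤ 2 * C.card := by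
      refine ⟨Nat.log 2 C.card + 1, (Nat.lt_pow_succ_log_self one_lt_two _).le, ?_⟩
      rw [pow_succ, mul_comm]
      exact Nat.mul_le_mul_left 2 (Nat.pow_log_le_self 2 h0)
    refine ⟨phaseStart (k + 1), ?_, hb, fun v => output_stateAfter hid.1 v _ fun u hu =>
      phaseStart_mono (Nat.succ_le_succ (solvingPhase_le hid.1 v hC hk1))⟩
    have h1 := phaseStart_le (k + 1)
    have h2 : 4 ^ (k + 1) = 4 * (2 ^ k) ^ 2 := by
      rw [← pow_mul, mul_comm k, pow_mul, pow_succ]; norm_num [mul_comm]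
    have h3 := Nat.pow_le_pow_left hk2 2
    rw [mul_pow] at h3
    omega

end Run

/-! ### Maximum matchings of a component from its kernel -/

section Component

variable {V : Type} [Fintype V] {G : SimpleGraph V} [DecidableRel G.Adj] {id : V → ℕ} {d : ℕ}
  (hid : Function.Injective id)
include hid

theorem adj_of_mem_componentTokens {v x y : V}
    (h : Nat.pair (id x) (id y) ∈ componentTokens G id d v) : G.Reachable v x ∧ G.Adj x y := by
  obtain ⟨x', hx', hm⟩ := mem_componentTokens.1 h
  obtain ⟨y', hxy, he⟩ := exists_of_mem_startTokens hm
  obtain ⟨h1, h2⟩ := Nat.pair_eq_pair.1 he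
  obtain rfl := hid h1
  obtain rfl := hid h2
  exact ⟨hx', hxy⟩

theorem adj_of_codeAdj {v x y : V} (h : CodeAdj (componentTokens G id d v) (id x) (id y)) :
    G.Reachable v x ∧ G.Adj x y := by
  rcases h with h | h
  · exact adj_of_mem_componentTokens hid h
  · obtain ⟨h1, h2⟩ := adj_of_mem_componentTokens hid h
    exact ⟨h1.trans h2.reachable, h2.symm⟩

omit hid in
theorem exists_of_codeAdj {v : V} {a b : ℕ} (h : CodeAdj (componentTokens G id d v) a b) :
    ∃ x y, id x = a ∧ id y = b := by
  rcases h with h | h <;>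
  · obtain ⟨x, -, hm⟩ := mem_componentTokens.1 h
    obtain ⟨y, -, he⟩ := exists_of_mem_startTokens hm
    obtain ⟨rfl, rfl⟩ := Nat.pair_eq_pair.1 he
    first
    | exact ⟨x, y, rfl, rfl⟩
    | exact ⟨y, x, rfl, rfl⟩

/-- A maximum matching of a sparse kernel is a maximum matching of the component. -/
theorem card_le_card_maxPairing_componentTokens {v : V}
    (hs : Sparse d (componentTokens G id d v)) {P : Finset (V × V)}
    (hP : IsPairing (fun a b => G.Reachable v a ∧ G.Adj a b) P) :
    P.card ≤ (maxPairing (componentTokens G id d v)).card := by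
  classical
  set X := componentTokens G id d v with hX
  -- Ordered pairs double the cover bound `d`; the `2 * d + 1` edges kept at high-degree vertices
  -- just exceed this.
  have hm : (maxPairing X).card ≤ 2 * d :=
    ((isPairing_maxPairing X).card_le_of_isCodeCover (isCodeCover_minCover X)).trans
      (Nat.mul_le_mul_left 2 hs.2)
  have hmem : ∀ {x m}, G.Reachable v x → m ∈ startTokens G id d x → m ∈ X := fun hx hm =>
    mem_componentTokens.2 ⟨_, hx, hm⟩
  have high : ∀ x, G.Reachable v x → 2 * d < G.degree x →
      ∃ Y : Finset V, (maxPairing X).card < Y.card ∧ ∀ y ∈ Y, CodeAdj X (id x) (id y) := by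
    intro x hx hdeg
    obtain ⟨Y, hY, hYt⟩ := exists_of_degree_gt hid hdeg
    exact ⟨Y, by omega, fun y hy => Or.inl (hmem hx (hYt y hy))⟩
  refine IsPairing.card_le_of_kernel (t := fun a b => CodeAdj X (id a) (id b)) ?_ ?_ ?_ ?_ P hP
  · rintro a b ⟨h1, h2⟩
    exact ⟨⟨h1.trans h2.reachable, h2.symm⟩, h2.ne⟩
  · intro a b h
    exact ⟨adj_of_codeAdj hid h, h.symm⟩
  · rintro a b ⟨h1, h2⟩
    by_cases ha : 2 * d < G.degree a
    · exact Or.inr (Or.inl (high a h1 ha))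
    by_cases hb : 2 * d < G.degree b
    · exact Or.inr (Or.inr (high b (h1.trans h2.reachable) hb))
    rw [not_lt] at ha hb
    exact Or.inl (Or.inl (hmem h1 ((mem_startTokens_of_degree_le hid ha).2 ⟨h2, hb⟩)))
  · intro M hM
    rw [← Finset.card_image_of_injective M (hid.prodMap hid)]
    exact card_le_card_maxPairing (hM.image id hid fun _ _ h => h)

end Component

/-! ### Pairings versus matchings as subgraphs -/

section Matching

variable {V : Type} [Fintype V] {G : SimpleGraph V}

open Classical in
theorem SimpleGraph.Subgraph.two_mul_ncard_edgeSet (M : G.Subgraph) :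
    2 * M.edgeSet.ncard = (Finset.univ.filter fun p : V × V => M.Adj p.1 p.2).card := by
  rw [← Subgraph.edgeSet_spanningCoe, ← SimpleGraph.coe_edgeFinset, Set.ncard_coe_finset,
    ← SimpleGraph.dart_card_eq_twice_card_edges, ← Finset.card_univ]
  refine Finset.card_bij (fun e _ => e.toProd) (fun e _ => ?_) (fun e _ e' _ h => ?_)
    fun p hp => ?_
  · simpa using e.adj
  · exact SimpleGraph.Dart.ext _ _ h
  · exact ⟨⟨p, (Finset.mem_filter.1 hp).2⟩, Finset.mem_univ _, rfl⟩

theorem IsPairing.exists_isMatching {P : Finset (V × V)} (h : IsPairing G.Adj P) :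
    ∃ M : G.Subgraph, M.IsMatching ∧ (∀ u w, M.Adj u w ↔ (u, w) ∈ P) ∧
      2 * M.edgeSet.ncard = P.card := by
  classical
  let M : G.Subgraph :=
    { verts := {u | ∃ w, (u, w) ∈ P}
      Adj := fun u w => (u, w) ∈ P
      adj_sub := fun {u w} huw => (h.1 u w huw).1
      edge_vert := fun {u w} huw => ⟨w, huw⟩
      symm := ⟨fun u w huw => (h.1 u w huw).2⟩ }
  refine ⟨M, fun u ⟨w, hw⟩ => ⟨w, hw, fun x hx => h.2 u x w hx hw⟩, fun u w => Iff.rfl, ?_⟩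
  rw [M.two_mul_ncard_edgeSet]
  congr 1
  ext p
  simp [M]

theorem SimpleGraph.Subgraph.IsMatching.exists_isPairing {M : G.Subgraph} (h : M.IsMatching) :
    ∃ P, IsPairing G.Adj P ∧ P.card = 2 * M.edgeSet.ncard := by
  classical
  refine ⟨_, ⟨fun a b hab => ?_, fun a b c hb hc => ?_⟩, M.two_mul_ncard_edgeSet.symm⟩
  · simp only [Finset.mem_filter, Finset.mem_univ, true_and] at hab ⊢
    exact ⟨hab.adj_sub, hab.symm⟩
  · simp only [Finset.mem_filter, Finset.mem_univ, true_and] at hb hc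
    exact h.eq_of_adj_left hb hc

theorem IsPairing.card_le_two_mul_card_univ {P : Finset (V × V)} (h : IsPairing G.Adj P) :
    P.card ≤ 2 * Fintype.card V := by
  classical
  exact h.card_le_two_mul Finset.univ (by simp)

variable (G) in
theorem bddAbove_matchingSizes :
    BddAbove {m | ∃ M : G.Subgraph, M.IsMatching ∧ M.edgeSet.ncard = m} := by
  refine ⟨Fintype.card V, ?_⟩
  rintro m ⟨M, hM, rfl⟩
  obtain ⟨P, hP, hc⟩ := hM.exists_isPairing
  have := hP.card_le_two_mul_card_univ
  omega

theorem IsPairing.card_le_two_mul_maxMatchingSize {P : Finset (V × V)} (h : IsPairing G.Adj P) :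
    P.card ≤ 2 * maxMatchingSize G := by
  obtain ⟨M, hM, -, hc⟩ := h.exists_isMatching
  rw [← hc]
  exact Nat.mul_le_mul_left 2 (le_csSup (bddAbove_matchingSizes G) ⟨M, hM, rfl⟩)

variable (G) in
theorem exists_isPairing_card_eq :
    ∃ P : Finset (V × V), IsPairing G.Adj P ∧ P.card = 2 * maxMatchingSize G := by
  obtain ⟨M₀, hM₀, -⟩ := (IsPairing.empty (r := G.Adj)).exists_isMatching
  obtain ⟨M, hM, hc⟩ := Nat.sSup_mem (s := {m | ∃ M : G.Subgraph, M.IsMatching ∧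
    M.edgeSet.ncard = m}) ⟨_, M₀, hM₀, rfl⟩ (bddAbove_matchingSizes G)
  obtain ⟨P, hP, hP2⟩ := hM.exists_isPairing
  exact ⟨P, hP, by rw [hP2, hc, maxMatchingSize]⟩

variable (G) in
theorem maxMatchingSize_le : maxMatchingSize G ≤ Fintype.card V := by
  obtain ⟨P, hP, hc⟩ := exists_isPairing_card_eq G
  have := hP.card_le_two_mul_card_univ
  omega

variable (G) in
/-- The endpoints of a maximum matching form a vertex cover. -/
theorem exists_cover_card_le_maxMatchingSize :
    ∃ C : Finset V, (∀ x y, G.Adj x y → x ∈ C ∨ y ∈ C) ∧ C.card ≤ 2 * maxMatchingSize G := by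
  classical
  obtain ⟨P, hP, hc⟩ := exists_isPairing_card_eq G
  refine ⟨P.image Prod.fst, fun x y hxy => ?_, hc ▸ Finset.card_image_le⟩
  by_contra! hcon
  have hx : ∀ w, (x, w) ∉ P := fun w hw => hcon.1 (Finset.mem_image_of_mem Prod.fst hw)
  have hy : ∀ w, (y, w) ∉ P := fun w hw => hcon.2 (Finset.mem_image_of_mem Prod.fst hw)
  have := (hP.insert hxy hxy.symm hxy.ne hx hy).card_le_two_mul_maxMatchingSize
  rw [IsPairing.card_insert hxy.ne hx hy] at this
  omega

theorem exists_cover_card_eq_vertexCoverNum (G : SimpleGraph V) :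
    ∃ C : Finset V, (∀ x y, G.Adj x y → x ∈ C ∨ y ∈ C) ∧ C.card = G.vertexCoverNum.toNat := by
  classical
  obtain ⟨s, hs, hcov⟩ := G.vertexCoverNum_exists
  refine ⟨s.toFinset, fun x y hxy => by simpa using hcov hxy, ?_⟩
  rw [← hs, Set.encard_eq_coe_toFinset_card, ENat.toNat_natCast]

end Matching

/-! ### Correctness of the outputs -/

/-- The output of a node in the algorithm for minimum vertex cover. -/
noncomputable def coverOutput (self : ℕ) (X : Finset ℕ) : Bool := decide (self ∈ minCover X)

/-- The output of a node in the algorithm for maximum matching. -/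
noncomputable def matchingOutput (self : ℕ) (X : Finset ℕ) : Finset ℕ :=
  ((maxPairing X).filter fun p => p.1 = self).image Prod.snd

section Correctness

variable {V : Type} [Fintype V] (G : SimpleGraph V) [DecidableRel G.Adj] (id : V → ℕ)

/-- The kernel from which node `v` computes its output. -/
noncomputable def solvedTokens (v : V) : Finset ℕ :=
  componentTokens G id (2 ^ solvingPhase G id v) v

variable {G id}

theorem solvedTokens_eq {u v : V} (h : G.Reachable u v) :
    solvedTokens G id u = solvedTokens G id v := by
  simp only [solvedTokens, solvingPhase_eq h, componentTokens_eq h]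

variable (hid : Function.Injective id)
include hid

/-- Both ends of an edge consult the same kernel, whose minimum cover is small enough to cover the
omitted edges too. -/
theorem isVertexCover_coverOutput :
    G.IsVertexCover {v | coverOutput (id v) (solvedTokens G id v) = true} := by
  intro x y hxy
  simp only [coverOutput, Set.mem_ofPred_eq, decide_eq_true_eq,
    ← solvedTokens_eq (id := id) hxy.reachable]
  have hs := sparse_solvingPhase (G := G) hid x
  have h := cover_of_cover_kernel (d := 2 ^ solvingPhase G id x) hid
    (X := solvedTokens G id x)
    (S := Finset.univ.filter fun u => id u ∈ minCover (solvedTokens G id x))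
    (((card_filter_id_le hid _).trans hs.2).trans (by omega))
    (fun a b hab => by simpa using isCodeCover_minCover _ _ _ hab) hxy
    (fun m hm => mem_componentTokens.2 ⟨x, SimpleGraph.Reachable.refl x, hm⟩)
    (fun m hm => mem_componentTokens.2 ⟨y, hxy.reachable, hm⟩)
  simpa using h

-- In each component the part of `C` inside it covers the kernel, hence is at least as large as the
-- minimum cover used there.
open Classical in
theorem card_coverOutput_le {C : Finset V} (hC : ∀ x y, G.Adj x y → x ∈ C ∨ y ∈ C) :
    {v | coverOutput (id v) (solvedTokens G id v) = true}.ncard ≤ C.card := by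
  have : {v | coverOutput (id v) (solvedTokens G id v) = true} =
      ((Finset.univ.filter fun v => id v ∈ minCover (solvedTokens G id v) : Finset V) : Set V) := by
    ext v
    simp [coverOutput]
  rw [this, Set.ncard_coe_finset,
    Finset.card_eq_sum_card_fiberwise (f := G.connectedComponentMk) (t := Finset.univ) (by simp),
    Finset.card_eq_sum_card_fiberwise (s := C) (f := G.connectedComponentMk) (t := Finset.univ)
      (by simp)]
  refine Finset.sum_le_sum fun c _ => ?_
  induction c using SimpleGraph.ConnectedComponent.ind with
  | _ v =>
  calc _ ≤ (minCover (solvedTokens G id v)).card := by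
        refine Finset.card_le_card_of_injOn id (fun u hu => ?_) hid.injOn
        obtain ⟨h1, h2⟩ := Finset.mem_filter.1 hu
        rw [← solvedTokens_eq (SimpleGraph.ConnectedComponent.exact h2)]
        exact (Finset.mem_filter.1 h1).2
    _ ≤ ((C.filter fun u => G.connectedComponentMk u = G.connectedComponentMk v).image id).card := by
        refine card_minCover_le (isCodeCover_image fun x y hx hxy => ?_)
        simp only [Finset.mem_filter]
        have h1 := SimpleGraph.ConnectedComponent.sound hx.symm
        have h2 := SimpleGraph.ConnectedComponent.sound (hx.trans hxy.reachable).symm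
        exact (hC x y hxy).imp (fun h => ⟨h, h1⟩) fun h => ⟨h, h2⟩
    _ ≤ _ := Finset.card_image_le

/-- The matching computed by the algorithm, as a set of ordered pairs. -/
theorem exists_isPairing_matchingOutput :
    ∃ P : Finset (V × V), IsPairing G.Adj P ∧
      (∀ v i, i ∈ matchingOutput (id v) (solvedTokens G id v) ↔ ∃ u, (v, u) ∈ P ∧ id u = i) ∧
      ∀ P', IsPairing G.Adj P' → P'.card ≤ P.card := by
  classical
  let P : Finset (V × V) :=
    Finset.univ.filter fun p => (id p.1, id p.2) ∈ maxPairing (solvedTokens G id p.1)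
  have hmem : ∀ a b, (a, b) ∈ P ↔ (id a, id b) ∈ maxPairing (solvedTokens G id a) := fun a b => by
    simp [P]
  have hpair : ∀ v, IsPairing (CodeAdj (solvedTokens G id v)) (maxPairing (solvedTokens G id v)) :=
    fun v => isPairing_maxPairing _
  refine ⟨P, ⟨fun a b hab => ?_, fun a b c hb hc => ?_⟩, fun v i => ?_, fun P' hP' => ?_⟩
  · rw [hmem] at hab
    obtain ⟨h1, h2⟩ := (hpair a).1 _ _ hab
    have hadj := (adj_of_codeAdj hid h1).2
    refine ⟨hadj, (hmem b a).2 ?_⟩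
    rwa [← solvedTokens_eq hadj.reachable]
  · rw [hmem] at hb hc
    exact hid ((hpair a).2 _ _ _ hb hc)
  · simp only [matchingOutput, Finset.mem_image, Finset.mem_filter, hmem]
    constructor
    · rintro ⟨⟨a, b⟩, ⟨h, rfl⟩, rfl⟩
      obtain ⟨-, u, -, rfl⟩ := exists_of_codeAdj ((hpair v).1 _ _ h).1
      exact ⟨u, h, rfl⟩
    · rintro ⟨u, h, rfl⟩
      exact ⟨_, ⟨h, rfl⟩, rfl⟩
  -- Optimality is checked per component, where all nodes use one and the same `maxPairing`.
  · rw [Finset.card_eq_sum_card_fiberwise (s := P') (f := fun p => G.connectedComponentMk p.1)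
      (t := Finset.univ) (by simp),
      Finset.card_eq_sum_card_fiberwise (s := P) (f := fun p => G.connectedComponentMk p.1)
      (t := Finset.univ) (by simp)]
    refine Finset.sum_le_sum fun c _ => ?_
    induction c using SimpleGraph.ConnectedComponent.ind with
    | _ v =>
    calc _ ≤ (maxPairing (solvedTokens G id v)).card := by
          refine card_le_card_maxPairing_componentTokens hid (sparse_solvingPhase hid v) ?_
          refine ⟨fun a b hab => ?_, fun a b c hb hc =>
            hP'.2 a b c (Finset.mem_filter.1 hb).1 (Finset.mem_filter.1 hc).1⟩
          obtain ⟨h1, h2⟩ := Finset.mem_filter.1 hab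
          obtain ⟨h3, h4⟩ := hP'.1 a b h1
          refine ⟨⟨(SimpleGraph.ConnectedComponent.exact h2).symm, h3⟩,
            Finset.mem_filter.2 ⟨h4, ?_⟩⟩
          rw [← h2]
          exact SimpleGraph.ConnectedComponent.sound h3.symm.reachable
      _ ≤ ((P.filter fun p => G.connectedComponentMk p.1 = G.connectedComponentMk v).image
            (Prod.map id id)).card := by
          refine Finset.card_le_card fun ⟨a, b⟩ hab => ?_
          have hadj := ((hpair v).1 _ _ hab).1
          obtain ⟨x, y, rfl, rfl⟩ := exists_of_codeAdj hadj
          have hr := (adj_of_codeAdj hid hadj).1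
          refine Finset.mem_image.2 ⟨(x, y), Finset.mem_filter.2 ⟨(hmem x y).2 ?_,
            SimpleGraph.ConnectedComponent.sound hr.symm⟩, rfl⟩
          rwa [← solvedTokens_eq hr]
      _ ≤ _ := Finset.card_image_le

end Correctness

/-! ### Round bounds and conclusion -/

/-- The constant doubles because `log (1 + x) ≥ log 2 ≥ 1 / 2`. For `opt = 0` no bound on `x` is
needed, as then `T = 0`; this matters for `x = opt`. -/
theorem rounds_le {T n opt : ℕ} {x : ℝ} (hT : T ≤ 256 * opt ^ 2) (hn : opt ≤ n)
    (hx : opt ≠ 0 → 1 ≤ x) :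
    (T : ℝ) ≤ 512 * min ((n : ℝ) ^ 2) ((opt : ℝ) ^ 2 * Real.log (1 + x)) := by
  have hT' : (T : ℝ) ≤ 256 * (opt : ℝ) ^ 2 := by exact_mod_cast hT
  by_cases h0 : opt = 0
  · subst h0
    simp only [Nat.cast_zero] at hT' ⊢
    rw [zero_pow two_ne_zero, zero_mul, min_eq_right (sq_nonneg _)]
    linarith
  have hn' : (opt : ℝ) ^ 2 ≤ (n : ℝ) ^ 2 := by exact_mod_cast Nat.pow_le_pow_left hn 2
  have hlog : 1 / 2 ≤ Real.log (1 + x) :=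
    (by linarith [Real.log_two_gt_d9] : (1 / 2 : ℝ) ≤ Real.log 2).trans
      (Real.log_le_log two_pos (by linarith [hx h0]))
  have hpos : 0 ≤ (opt : ℝ) ^ 2 := sq_nonneg _
  rw [mul_min_of_nonneg _ _ (by norm_num)]
  refine le_min (by linarith) ?_
  nlinarith [mul_le_mul_of_nonneg_left hlog hpos]

theorem approximatesMVC_kernelAlgorithm (c : ℕ) {α : ℝ} (hα : 1 ≤ α) {x : ℕ → ℝ}
    (hx : ∀ opt, opt ≠ 0 → 1 ≤ x opt) :
    ApproximatesMVC (kernelAlgorithm coverOutput) c (2 * c + 1) α fun n opt =>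
      512 * min ((n : ℝ) ^ 2) ((opt : ℝ) ^ 2 * Real.log (1 + x opt)) := by
  intro V _ G _ id hid
  obtain ⟨C, hC, hCc⟩ := exists_cover_card_eq_vertexCoverNum G
  obtain ⟨T, hT, hcomp⟩ := kernelAlgorithm_computes (f := coverOutput) hid hC
  refine ⟨T, _, rounds_le (by rw [← hCc]; omega) (hCc ▸ Finset.card_le_univ C) (hx _), hcomp,
    isVertexCover_coverOutput hid.1, ?_⟩
  have h := card_coverOutput_le hid.1 hC
  rw [hCc] at h
  have h' : (({v | coverOutput (id v) (solvedTokens G id v) = true}.ncard : ℕ) : ℝ) ≤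
    (G.vertexCoverNum.toNat : ℝ) := by exact_mod_cast h
  exact h'.trans (le_mul_of_one_le_left (Nat.cast_nonneg _) hα)

theorem approximatesMaxM_kernelAlgorithm (c : ℕ) {α : ℝ} (hα : 1 ≤ α) {x : ℕ → ℝ}
    (hx : ∀ opt, opt ≠ 0 → 1 ≤ x opt) :
    ApproximatesMaxM (kernelAlgorithm matchingOutput) c (2 * c + 1) α fun n opt =>
      512 * min ((n : ℝ) ^ 2) ((opt : ℝ) ^ 2 * Real.log (1 + x opt)) := by
  intro V _ G _ id hid
  obtain ⟨C, hC, hCc⟩ := exists_cover_card_le_maxMatchingSize G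
  obtain ⟨T, hT, hcomp⟩ := kernelAlgorithm_computes (f := matchingOutput) hid hC
  obtain ⟨P, hP, hout, hmax⟩ := exists_isPairing_matchingOutput (G := G) hid.1
  obtain ⟨M, hM, hMP, hMc⟩ := hP.exists_isMatching
  obtain ⟨P', hP', hP'c⟩ := exists_isPairing_card_eq G
  have hle := hmax P' hP'
  -- The cover by matched vertices has up to `2 * OPT` elements, which turns `64` into `256`.
  have hT2 : T ≤ 256 * maxMatchingSize G ^ 2 := by
    have := Nat.pow_le_pow_left hCc 2
    rw [mul_pow] at this
    omega
  refine ⟨T, _, M, rounds_le hT2 (maxMatchingSize_le G) (hx _), hcomp, fun v i => ?_, hM, ?_⟩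
  · simp only [hMP]
    exact hout v i
  · have h : (maxMatchingSize G : ℝ) ≤ (M.edgeSet.ncard : ℝ) := by
      exact_mod_cast (by omega : maxMatchingSize G ≤ M.edgeSet.ncard)
    exact (div_le_self (Nat.cast_nonneg _) hα).trans h

theorem mainTheorem3 :
    ∃ C : ℝ, ∀ c : ℕ, ∃ B : ℕ,
      (∀ ε : ℝ, 0 < ε → ε < 1 →
        (∃ A : DistAlgorithm Bool, ApproximatesMVC A c B (1 + ε) fun n opt =>
          C * min ((n : ℝ) ^ 2) ((opt : ℝ) ^ 2 * Real.log (1 + 1 / ε))) ∧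
        (∃ A : DistAlgorithm (Finset ℕ), ApproximatesMaxM A c B (1 + ε) fun n opt =>
          C * min ((n : ℝ) ^ 2) ((opt : ℝ) ^ 2 * Real.log (1 + 1 / ε)))) ∧
      (∃ A : DistAlgorithm Bool, ApproximatesMVC A c B 1 fun n opt =>
        C * min ((n : ℝ) ^ 2) ((opt : ℝ) ^ 2 * Real.log (1 + opt))) ∧
      (∃ A : DistAlgorithm (Finset ℕ), ApproximatesMaxM A c B 1 fun n opt =>
        C * min ((n : ℝ) ^ 2) ((opt : ℝ) ^ 2 * Real.log (1 + opt))) := by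
  refine ⟨512, fun c => ⟨2 * c + 1, fun ε h0 h1 => ?_, ?_, ?_⟩⟩
  · have hx : ∀ opt : ℕ, opt ≠ 0 → 1 ≤ 1 / ε := fun _ _ => (one_le_div h0).2 h1.le
    exact ⟨⟨_, approximatesMVC_kernelAlgorithm c (by linarith) hx⟩,
      ⟨_, approximatesMaxM_kernelAlgorithm c (by linarith) hx⟩⟩
  · exact ⟨_, approximatesMVC_kernelAlgorithm c le_rfl (x := fun opt => opt)
      fun opt h => Nat.one_le_cast.2 (Nat.pos_of_ne_zero h)⟩
  · exact ⟨_, approximatesMaxM_kernelAlgorithm c le_rfl (x := fun opt => opt)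
      fun opt h => Nat.one_le_cast.2 (Nat.pos_of_ne_zero h)⟩
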